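/- Let $\theta\in(0,\pi/4]$ and let $\alpha,\beta,\gamma>0$ be real numbers with $\alpha^2+\beta^2+\gamma^2=1$. Alice and Bob share the two-qubit link $|\psi(\theta)\rangle_{AB}=\cos\theta\,|00\rangle+\sin\theta\,|11\rangle$ ($A$ with Alice, $B$ with Bob), and a Bank distributes the three-qubit W-class state $|W\rangle_{A'B'K}=\alpha|001\rangle+\beta|010\rangle+\gamma|100\rangle$, sending $A'$ to Alice and $B'$ to Bob. In the transfer model the Bank then hands its qubit $K$ over to Alice and leaves, so that Alice holds $AA'K$ and Bob holds $BB'$ of the pure state $|\psi(\theta)\rangle_{AB}\otimes|W\rangle_{A'B'K}$. Say that Alice and Bob can deterministically restore a Bell pair on $AB$ by LOCC if there is a finite-round protocol of local operations (finite-outcome measurements and channels on finite-dimensional systems, local ancillas and discarding allowed) and two-way classical communication, across the cut $AA'K\mid BB'$, after which the registers $A,B$ are with certainty in the state $|\Phi^+\rangle=\tfrac{1}{\sqrt2}(|00\rangle+|11\rangle)$, with arbitrary leftover registers on either side. Then Alice and Bob can deterministically restore a Bell pair on $AB$ by LOCC in the transfer model if and only if $$\frac{1-\tan^2\theta}{2}\;\le\;\beta^2\;\le\;\frac{1+\tan^2\theta}{2}.$$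 -/

import Mathlib

open scoped Kronecker Matrix

/-- Label set of the computational basis of one qubit. -/
abbrev Qubit : Type := Fin 2

/-- The computational basis vector `|i⟩`; vectors of a finite-dimensional register are given by
their coordinates in the computational basis. -/
def basisKet {ι : Type} [DecidableEq ι] (i : ι) : ι → ℂ := Pi.single i 1

/-- Tensor product of vectors. -/
def tensorKet {ι κ : Type} (u : ι → ℂ) (v : κ → ℂ) : ι × κ → ℂ := fun p => u p.1 * v p.2

/-- The operator `|v⟩⟨v|`. -/
def pureState {ι : Type} (v : ι → ℂ) : Matrix ι ι ℂ := Matrix.vecMulVec v (star v)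

/-- `K` is the family of operators of a measurement with finitely many outcomes,
`∑ i, (K i)† (K i) = 1`. The system left after outcome `i` has basis `c i`, which may depend on the
outcome. -/
def IsMeasurement {n : ℕ} {a : Type} [Fintype a] [DecidableEq a] {c : Fin n → Type}
    [∀ i, Fintype (c i)] (K : ∀ i, Matrix (c i) a ℂ) : Prop :=
  ∑ i, (K i)ᴴ * K i = 1

/-- `IsLOCC Λ`: the map `Λ`, from operators on the bipartite system `a ⊗ b` to operators on
`a' ⊗ b'` (first factor Alice's, second factor Bob's), is implemented by a finite protocol of local
operations and classical communication. A protocol is a finite tree. At an inner node Alice (or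
Bob) makes a local measurement and announces the outcome, and both go on with a protocol that
depends on it; at a leaf each applies a local quantum channel, given by its Kraus operators, without
further communication. The outcomes are averaged over. The dimensions of the local systems may
change in every step, so that adding local ancillas and discarding subsystems are included. -/
inductive IsLOCC {a' b' : Type} [Fintype a'] [Fintype b'] :
    ∀ {a b : Type} [Fintype a] [DecidableEq a] [Fintype b] [DecidableEq b],
      (Matrix (a × b) (a × b) ℂ → Matrix (a' × b') (a' × b') ℂ) → Prop
  | leaf {a b : Type} [Fintype a] [DecidableEq a] [Fintype b] [DecidableEq b] {m n : ℕ}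
      (K : Fin m → Matrix a' a ℂ) (L : Fin n → Matrix b' b ℂ)
      (hK : IsMeasurement K) (hL : IsMeasurement L) :
      IsLOCC fun ρ : Matrix (a × b) (a × b) ℂ =>
        ∑ i, ∑ j, (K i ⊗ₖ L j) * ρ * (K i ⊗ₖ L j)ᴴ
  | alice {a b : Type} [Fintype a] [DecidableEq a] [Fintype b] [DecidableEq b] {m : ℕ}
      (d : Fin m → ℕ) (K : ∀ i, Matrix (Fin (d i)) a ℂ) (hK : IsMeasurement K)
      (Λ : ∀ i, Matrix (Fin (d i) × b) (Fin (d i) × b) ℂ → Matrix (a' × b') (a' × b') ℂ)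
      (hΛ : ∀ i, IsLOCC (Λ i)) :
      IsLOCC fun ρ : Matrix (a × b) (a × b) ℂ =>
        ∑ i, Λ i ((K i ⊗ₖ (1 : Matrix b b ℂ)) * ρ * (K i ⊗ₖ (1 : Matrix b b ℂ))ᴴ)
  | bob {a b : Type} [Fintype a] [DecidableEq a] [Fintype b] [DecidableEq b] {n : ℕ}
      (d : Fin n → ℕ) (L : ∀ j, Matrix (Fin (d j)) b ℂ) (hL : IsMeasurement L)
      (Λ : ∀ j, Matrix (a × Fin (d j)) (a × Fin (d j)) ℂ → Matrix (a' × b') (a' × b') ℂ)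
      (hΛ : ∀ j, IsLOCC (Λ j)) :
      IsLOCC fun ρ : Matrix (a × b) (a × b) ℂ =>
        ∑ j, Λ j (((1 : Matrix a a ℂ) ⊗ₖ L j) * ρ * ((1 : Matrix a a ℂ) ⊗ₖ L j)ᴴ)

/-- The reduced operator on the registers `A`, `B` of an operator on `A R | B S`: the partial trace
over Alice's leftover register `R` and Bob's leftover register `S`. -/
def reducedAB {R S : Type} [Fintype R] [Fintype S]
    (ρ : Matrix ((Qubit × R) × (Qubit × S)) ((Qubit × R) × (Qubit × S)) ℂ) :
    Matrix (Qubit × Qubit) (Qubit × Qubit) ℂ :=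
  fun p q => ∑ r, ∑ s, ρ ((p.1, r), (p.2, s)) ((q.1, r), (q.2, s))

/-- The Bell vector `(|00⟩ + |11⟩) / √2`. -/
noncomputable def bellKet : Qubit × Qubit → ℂ :=
  ((1 / Real.sqrt 2 : ℝ) : ℂ) • (basisKet (0, 0) + basisKet (1, 1))

/-- From the pure state `Ψ` on `A X | B Y`, Alice and Bob can deterministically produce a Bell pair
on the registers `A B` by LOCC, with arbitrary leftover registers. -/
def CanRestoreBell {X Y : Type} [Fintype X] [DecidableEq X] [Fintype Y] [DecidableEq Y]
    (Ψ : (Qubit × X) × (Qubit × Y) → ℂ) : Prop :=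
  ∃ (r s : ℕ) (Λ : Matrix ((Qubit × X) × (Qubit × Y)) ((Qubit × X) × (Qubit × Y)) ℂ →
      Matrix ((Qubit × Fin r) × (Qubit × Fin s)) ((Qubit × Fin r) × (Qubit × Fin s)) ℂ),
    IsLOCC Λ ∧ reducedAB (Λ (pureState Ψ)) = pureState bellKet

/-- The link `cos θ |00⟩ + sin θ |11⟩` on `A B`. -/
noncomputable def linkKet (θ : ℝ) : Qubit × Qubit → ℂ :=
  (Real.cos θ : ℂ) • basisKet (0, 0) + (Real.sin θ : ℂ) • basisKet (1, 1)

/-- The W-class vector `α |001⟩ + β |010⟩ + γ |100⟩` on `A' B' K`. -/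
def wKet (α β γ : ℝ) : Qubit × Qubit × Qubit → ℂ :=
  (α : ℂ) • basisKet (0, 0, 1) + (β : ℂ) • basisKet (0, 1, 0) + (γ : ℂ) • basisKet (1, 0, 0)

/-- Transfer of `K` to Alice: a vector on `(A B) (A' B' K)` is regarded as a vector on the bipartite
system `A A' K | B B'`. -/
def transferToAlice (Ψ : (Qubit × Qubit) × (Qubit × Qubit × Qubit) → ℂ) :
    (Qubit × Qubit × Qubit) × (Qubit × Qubit) → ℂ :=
  fun p => Ψ ((p.1.1, p.2.1), (p.1.2.1, p.2.2, p.1.2.2))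

/-- In the transfer model, with link angle `θ` and Bank state `Ω` on `A' B' K`, Alice and Bob can
deterministically restore a Bell pair on `A B` by LOCC. -/
def TransferRestorable (θ : ℝ) (Ω : Qubit × Qubit × Qubit → ℂ) : Prop :=
  CanRestoreBell (transferToAlice (tensorKet (linkKet θ) Ω))

/-! With `K` at Alice, Bob's basis is a Schmidt basis, with weights the products of {cos² θ, sin² θ}
and {α² + γ², β²}. As sin θ ≤ cos θ, the theorem says that a Bell pair can be restored iff the
largest weight is at most 1/2.

Necessity: the largest weight is the squared operator norm of the coefficient matrix. Completeness
of a local measurement makes bounds on it add up over outcomes (`SchmidtBound.of_alice`,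
`SchmidtBound.of_bob`). In the final ensemble every member is a Bell pair times a leftover vector,
so half its squared norm is a bound; these halves add up to 1/2.

Sufficiency: four weights of sum 1, none above 1/2, are a nonnegative combination of indicators of
two-element sets (`exists_pair_weights`). Bob measures which pair, flattening its two coefficients,
and Alice rotates her two Schmidt vectors into `A` (`canRestoreBell_of_pairs`). -/

theorem mul_pureState_mul_conjTranspose {ι κ : Type} [Fintype ι] (M : Matrix κ ι ℂ) (v : ι → ℂ) :
    M * pureState v * Mᴴ = pureState (M *ᵥ v) := by
  rw [pureState, pureState, Matrix.mul_vecMulVec, Matrix.vecMulVec_mul, Matrix.star_mulVec]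

/-- The squared norm of a vector. -/
noncomputable def sqNorm {ι : Type} [Fintype ι] (v : ι → ℂ) : ℝ := ∑ i, ‖v i‖ ^ 2

theorem sqNorm_nonneg {ι : Type} [Fintype ι] (v : ι → ℂ) : 0 ≤ sqNorm v :=
  Finset.sum_nonneg fun _ _ => sq_nonneg _

theorem sqNorm_star {ι : Type} [Fintype ι] (v : ι → ℂ) : sqNorm (star v) = sqNorm v := by
  simp [sqNorm]

theorem star_dotProduct_self {ι : Type} [Fintype ι] (v : ι → ℂ) :
    star v ⬝ᵥ v = (sqNorm v : ℂ) := by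
  simp [sqNorm, dotProduct, Complex.conj_mul']

theorem norm_sum_sq_le {ι : Type} [Fintype ι] (u v : ι → ℂ) :
    ‖u ⬝ᵥ v‖ ^ 2 ≤ sqNorm u * sqNorm v := by
  have h : ‖u ⬝ᵥ v‖ ≤ ∑ i, ‖u i‖ * ‖v i‖ :=
    (norm_sum_le _ _).trans (Finset.sum_le_sum fun i _ => (norm_mul _ _).le)
  calc ‖u ⬝ᵥ v‖ ^ 2 ≤ (∑ i, ‖u i‖ * ‖v i‖) ^ 2 := by gcongr
    _ ≤ _ := Finset.sum_mul_sq_le_sq_mul_sq _ _ _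

/-- Completeness of a measurement: the outcome probabilities add up. -/
theorem IsMeasurement.sum_sqNorm {n : ℕ} {a : Type} [Fintype a] [DecidableEq a]
    {c : Fin n → Type} [∀ i, Fintype (c i)] {K : ∀ i, Matrix (c i) a ℂ} (hK : IsMeasurement K)
    (v : a → ℂ) : ∑ i, sqNorm (K i *ᵥ v) = sqNorm v := by
  have h : ∑ i, ((sqNorm (K i *ᵥ v) : ℝ) : ℂ) = sqNorm v := by
    simp_rw [← star_dotProduct_self, Matrix.star_mulVec, ← Matrix.dotProduct_mulVec,
      Matrix.mulVec_mulVec]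
    rw [← dotProduct_sum, ← Matrix.sum_mulVec, hK, Matrix.one_mulVec]
  exact_mod_cast h

/-! ### Largest Schmidt coefficient along an LOCC protocol -/

/-- All squared Schmidt coefficients of the bipartite vector `ψ` are at most `l`. -/
def SchmidtBound {a b : Type} [Fintype a] [Fintype b] (ψ : a × b → ℂ) (l : ℝ) : Prop :=
  0 ≤ l ∧ ∀ u v, ‖u ⬝ᵥ (Matrix.of fun x y => ψ (x, y)) *ᵥ v‖ ^ 2 ≤ l * (sqNorm u * sqNorm v)

theorem le_of_sq_le_mul_self {x y : ℝ} (hx : 0 ≤ x) (hy : 0 ≤ y) (h : x ^ 2 ≤ y * x) : x ≤ y := by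
  rcases hx.eq_or_lt with h0 | h0
  · exact h0 ▸ hy
  · exact le_of_mul_le_mul_right (by rwa [← sq]) h0

section
variable {a b c d : Type} [Fintype a] [Fintype b] [Fintype c] [Fintype d]

/-- Test the bilinear bound on the conjugate of the image vector and cancel one factor of its
squared norm. -/
theorem SchmidtBound.sqNorm_mulVec_le {ψ : a × b → ℂ} {l : ℝ} (h : SchmidtBound ψ l)
    (v : b → ℂ) : sqNorm ((Matrix.of fun x y => ψ (x, y)) *ᵥ v) ≤ l * sqNorm v := by
  set w := (Matrix.of fun x y => ψ (x, y)) *ᵥ v with hw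
  have h1 := h.2 (star w) v
  rw [← hw, star_dotProduct_self, sqNorm_star, Complex.norm_real, Real.norm_of_nonneg
    (sqNorm_nonneg _)] at h1
  exact le_of_sq_le_mul_self (sqNorm_nonneg _) (mul_nonneg h.1 (sqNorm_nonneg _))
    (h1.trans_eq (by ring))

theorem SchmidtBound.sqNorm_vecMul_le {ψ : a × b → ℂ} {l : ℝ} (h : SchmidtBound ψ l)
    (u : a → ℂ) : sqNorm (u ᵥ* (Matrix.of fun x y => ψ (x, y))) ≤ l * sqNorm u := by
  set w := u ᵥ* (Matrix.of fun x y => ψ (x, y)) with hw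
  have h1 := h.2 u (star w)
  rw [Matrix.dotProduct_mulVec, ← hw, dotProduct_comm, star_dotProduct_self, sqNorm_star,
    Complex.norm_real, Real.norm_of_nonneg (sqNorm_nonneg _)] at h1
  exact le_of_sq_le_mul_self (sqNorm_nonneg _) (mul_nonneg h.1 (sqNorm_nonneg _))
    (h1.trans_eq (by ring))

omit [Fintype c] [Fintype d] in
theorem of_kronecker_mulVec (K : Matrix c a ℂ) (L : Matrix d b ℂ) (ψ : a × b → ℂ) :
    (Matrix.of fun x y => ((K ⊗ₖ L) *ᵥ ψ) (x, y)) =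
      K * (Matrix.of fun x y => ψ (x, y)) * Lᵀ := by
  ext x y
  simp only [Matrix.of_apply, Matrix.mulVec, dotProduct, Fintype.sum_prod_type,
    Matrix.kroneckerMap_apply, Matrix.mul_apply, Matrix.transpose_apply, Finset.sum_mul]
  rw [Finset.sum_comm]
  exact Finset.sum_congr rfl fun _ _ => Finset.sum_congr rfl fun _ _ => by ring

/-- With coefficient matrix `M` of `ψ`, completeness gives ‖Mv‖² = ∑ ‖Kᵢ M v‖², and each term is
bounded by hypothesis. -/
theorem SchmidtBound.of_alice [DecidableEq a] [DecidableEq b] {m : ℕ} {c : Fin m → Type}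
    [∀ i, Fintype (c i)] {K : ∀ i, Matrix (c i) a ℂ} (hK : IsMeasurement K) {ψ : a × b → ℂ}
    {l : Fin m → ℝ}
    (h : ∀ i, SchmidtBound ((K i ⊗ₖ (1 : Matrix b b ℂ)) *ᵥ ψ) (l i)) :
    SchmidtBound ψ (∑ i, l i) := by
  refine ⟨Finset.sum_nonneg fun i _ => (h i).1, fun u v => ?_⟩
  refine (norm_sum_sq_le _ _).trans ?_
  rw [← hK.sum_sqNorm (_ *ᵥ v), mul_left_comm]
  refine mul_le_mul_of_nonneg_left ?_ (sqNorm_nonneg _)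
  rw [Finset.sum_mul]
  refine Finset.sum_le_sum fun i _ => ?_
  have := (h i).sqNorm_mulVec_le v
  rwa [of_kronecker_mulVec, Matrix.transpose_one, Matrix.mul_one, ← Matrix.mulVec_mulVec] at this

theorem SchmidtBound.of_bob [DecidableEq a] [DecidableEq b] {m : ℕ} {c : Fin m → Type}
    [∀ i, Fintype (c i)] {L : ∀ i, Matrix (c i) b ℂ} (hL : IsMeasurement L) {ψ : a × b → ℂ}
    {l : Fin m → ℝ}
    (h : ∀ i, SchmidtBound (((1 : Matrix a a ℂ) ⊗ₖ L i) *ᵥ ψ) (l i)) :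
    SchmidtBound ψ (∑ i, l i) := by
  refine ⟨Finset.sum_nonneg fun i _ => (h i).1, fun u v => ?_⟩
  rw [Matrix.dotProduct_mulVec]
  refine (norm_sum_sq_le _ _).trans ?_
  rw [← hL.sum_sqNorm (u ᵥ* _), ← mul_assoc]
  refine mul_le_mul_of_nonneg_right ?_ (sqNorm_nonneg _)
  rw [Finset.sum_mul]
  refine Finset.sum_le_sum fun i _ => ?_
  have := (h i).sqNorm_vecMul_le u
  rwa [of_kronecker_mulVec, Matrix.one_mul, ← Matrix.vecMul_vecMul, Matrix.vecMul_transpose]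
    at this

/-- An LOCC map turns a pure state into an ensemble of pure states, and bounds on the largest
Schmidt coefficients of its (unnormalized) members add up to a bound for the initial state. -/
theorem IsLOCC.exists_ensemble [DecidableEq a] [DecidableEq b]
    {Λ : Matrix (a × b) (a × b) ℂ → Matrix (c × d) (c × d) ℂ} (hΛ : IsLOCC Λ) (ψ : a × b → ℂ) :
    ∃ (ι : Type) (_ : Fintype ι) (φ : ι → c × d → ℂ),
      Λ (pureState ψ) = ∑ k, pureState (φ k) ∧
      ∀ l : ι → ℝ, (∀ k, SchmidtBound (φ k) (l k)) → SchmidtBound ψ (∑ k, l k) := by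
  induction hΛ with
  | @leaf a b _ _ _ _ m n K L hK hL =>
    refine ⟨Fin m × Fin n, inferInstance, fun k => (K k.1 ⊗ₖ L k.2) *ᵥ ψ, ?_, fun l hl => ?_⟩
    · simp [mul_pureState_mul_conjTranspose, Fintype.sum_prod_type]
    · rw [Fintype.sum_prod_type]
      refine SchmidtBound.of_alice hK fun i => ?_
      classical
      refine SchmidtBound.of_bob hL fun j => ?_
      rw [Matrix.mulVec_mulVec, ← Matrix.mul_kronecker_mul, Matrix.one_mul, Matrix.mul_one]
      exact hl (i, j)
  | alice e K hK Λ hΛ ih =>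
    choose ι hι φ h1 h2 using fun i => ih i ((K i ⊗ₖ 1) *ᵥ ψ)
    refine ⟨Σ i, ι i, inferInstance, fun k => φ k.1 k.2, ?_, fun l hl => ?_⟩
    · simp [mul_pureState_mul_conjTranspose, Fintype.sum_sigma, h1]
    · rw [Fintype.sum_sigma]
      exact SchmidtBound.of_alice hK fun i => h2 i _ fun k => hl ⟨i, k⟩
  | bob e L hL Λ hΛ ih =>
    choose ι hι φ h1 h2 using fun i => ih i ((1 ⊗ₖ L i) *ᵥ ψ)
    refine ⟨Σ i, ι i, inferInstance, fun k => φ k.1 k.2, ?_, fun l hl => ?_⟩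
    · simp [mul_pureState_mul_conjTranspose, Fintype.sum_sigma, h1]
    · rw [Fintype.sum_sigma]
      exact SchmidtBound.of_bob hL fun i => h2 i _ fun k => hl ⟨i, k⟩

end

/-! ### Necessity: ensembles that reduce to the Bell pair -/

section
variable {R S : Type} [Fintype R] [Fintype S]

theorem reducedAB_sum {ι : Type} [Fintype ι]
    (ρ : ι → Matrix ((Qubit × R) × (Qubit × S)) ((Qubit × R) × (Qubit × S)) ℂ) :
    reducedAB (∑ k, ρ k) = ∑ k, reducedAB (ρ k) := by
  ext p q
  simp only [reducedAB, Matrix.sum_apply]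
  exact (Finset.sum_congr rfl fun r _ => Finset.sum_comm).trans Finset.sum_comm

theorem reducedAB_pureState (φ : (Qubit × R) × (Qubit × S) → ℂ) :
    reducedAB (pureState φ) = ∑ r, ∑ s, pureState fun p => φ ((p.1, r), (p.2, s)) := by
  ext p q
  simp [reducedAB, Matrix.sum_apply, pureState, Matrix.vecMulVec_apply]

theorem dotProduct_pureState_mulVec {ι : Type} [Fintype ι] (f w : ι → ℂ) :
    w ⬝ᵥ (pureState f *ᵥ star w) = ((‖w ⬝ᵥ f‖ ^ 2 : ℝ) : ℂ) := by
  rw [pureState, Matrix.vecMulVec_mulVec, Matrix.star_dotProduct_star,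
    dotProduct_smul]
  simp [Complex.mul_conj']

theorem pureState_bellKet_apply (p q : Qubit × Qubit) :
    pureState bellKet p q = if p.1 = p.2 ∧ q.1 = q.2 then 1 / 2 else 0 := by
  have h : ((√2 : ℝ) : ℂ) * ((√2 : ℝ) : ℂ) = 2 := by
    rw [← Complex.ofReal_mul, Real.mul_self_sqrt zero_le_two]; norm_num
  obtain ⟨p1, p2⟩ := p
  obtain ⟨q1, q2⟩ := q
  fin_cases p1 <;> fin_cases p2 <;> fin_cases q1 <;> fin_cases q2 <;>
    simp [pureState, bellKet, basisKet, Matrix.vecMulVec_apply, ← mul_inv, h]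

/-- If an ensemble of vectors reduces to the Bell pair, each member is a Bell pair with leftover
registers in some vector. -/
theorem eq_of_sum_reducedAB_eq_bell {ι : Type} [Fintype ι]
    {φ : ι → (Qubit × R) × (Qubit × S) → ℂ}
    (h : ∑ k, reducedAB (pureState (φ k)) = pureState bellKet) (k : ι) (i j : Qubit) (r : R)
    (s : S) : φ k ((i, r), (j, s)) = if i = j then φ k ((0, r), (0, s)) else 0 := by
  -- A vanishing Bell expectation is a vanishing sum of squares over the ensemble, so every term is
  -- zero.
  have key : ∀ w : Qubit × Qubit → ℂ, w ⬝ᵥ (pureState bellKet *ᵥ star w) = 0 →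
      ∑ p, w p * φ k ((p.1, r), (p.2, s)) = 0 := by
    intro w hw
    have h1 : ∑ k, ∑ r, ∑ s, ‖∑ p, w p * φ k ((p.1, r), (p.2, s))‖ ^ 2 = 0 := by
      have : ((∑ k, ∑ r, ∑ s, ‖∑ p, w p * φ k ((p.1, r), (p.2, s))‖ ^ 2 : ℝ) : ℂ) = 0 := by
        rw [← hw, ← h]
        simp_rw [reducedAB_pureState, Matrix.sum_mulVec, dotProduct_sum,
          dotProduct_pureState_mulVec]
        simp [dotProduct]
      exact_mod_cast this
    rw [Finset.sum_eq_zero_iff_of_nonneg (fun _ _ => by positivity)] at h1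
    have h2 := h1 k (Finset.mem_univ _)
    rw [Finset.sum_eq_zero_iff_of_nonneg (fun _ _ => by positivity)] at h2
    have h3 := h2 r (Finset.mem_univ _)
    rw [Finset.sum_eq_zero_iff_of_nonneg (fun _ _ => by positivity)] at h3
    simpa using h3 s (Finset.mem_univ _)
  simp_rw [dotProduct, Matrix.mulVec, dotProduct, pureState_bellKet_apply] at key
  -- These three test vectors span the orthogonal complement of the Bell vector.
  have h01 := key (Pi.single (0, 1) 1) (by simp [Fintype.sum_prod_type])
  have h10 := key (Pi.single (1, 0) 1) (by simp [Fintype.sum_prod_type])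
  have h11 := key (Pi.single (1, 1) 1 - Pi.single (0, 0) 1)
    (by simp [Fintype.sum_prod_type, Pi.single_apply])
  simp [Fintype.sum_prod_type, Pi.single_apply] at h01 h10 h11
  fin_cases i <;> fin_cases j <;> simp [h01, h10]
  linear_combination h11

/-- A Bell pair with leftover registers in the vector `χ`. -/
theorem schmidtBound_of_bell {φ : (Qubit × R) × (Qubit × S) → ℂ} {χ : R → S → ℂ}
    (h : ∀ i j r s, φ ((i, r), (j, s)) = if i = j then χ r s else 0) :
    SchmidtBound φ (∑ r, ∑ s, ‖χ r s‖ ^ 2) := by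
  refine ⟨by positivity, fun u v => ?_⟩
  have h1 : u ⬝ᵥ (Matrix.of fun x y => φ (x, y)) *ᵥ v =
      (fun p : R × S => χ p.1 p.2) ⬝ᵥ
        fun p : R × S => (fun i : Qubit => u (i, p.1)) ⬝ᵥ fun i => v (i, p.2) := by
    simp only [dotProduct, Matrix.mulVec, Matrix.of_apply, Fintype.sum_prod_type,
      Fin.sum_univ_two, h, ← Finset.sum_add_distrib, Finset.mul_sum]
    refine Finset.sum_congr rfl fun r _ => Finset.sum_congr rfl fun s _ => ?_
    simp
    ring
  rw [h1]
  -- Cauchy–Schwarz twice: over the leftover indices, then over the qubit index.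
  refine (norm_sum_sq_le _ _).trans ?_
  rw [sqNorm, Fintype.sum_prod_type]
  refine mul_le_mul_of_nonneg_left ?_ (by positivity)
  calc _ ≤ ∑ p : R × S, sqNorm (fun i : Qubit => u (i, p.1)) * sqNorm (fun i => v (i, p.2)) :=
        Finset.sum_le_sum fun p _ => norm_sum_sq_le _ _
    _ = _ := by
        simp only [sqNorm, Fintype.sum_prod_type_right, Finset.sum_mul_sum]
        rw [Finset.sum_comm]

/-- A state from which a Bell pair can be restored has no squared Schmidt coefficient
above `1 / 2`. -/
theorem CanRestoreBell.schmidtBound {X Y : Type} [Fintype X] [DecidableEq X] [Fintype Y]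
    [DecidableEq Y] {Ψ : (Qubit × X) × (Qubit × Y) → ℂ} (h : CanRestoreBell Ψ) :
    SchmidtBound Ψ (1 / 2) := by
  obtain ⟨r, s, Λ, hΛ, h⟩ := h
  obtain ⟨ι, _, φ, h1, h2⟩ := hΛ.exists_ensemble Ψ
  rw [h1, reducedAB_sum] at h
  have h3 := h2 _ fun k => schmidtBound_of_bell (eq_of_sum_reducedAB_eq_bell h k)
  convert h3
  have h4 := congr_fun (congr_fun h (0, 0)) (0, 0)
  simp [pureState_bellKet_apply, Matrix.sum_apply, reducedAB_pureState] at h4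
  simp [pureState, Matrix.vecMulVec_apply, Complex.mul_conj'] at h4
  apply Complex.ofReal_injective
  push_cast
  rw [one_div, h4]

theorem CanRestoreBell.le_half {X Y : Type} [Fintype X] [DecidableEq X] [Fintype Y]
    [DecidableEq Y] {Ψ : (Qubit × X) × (Qubit × Y) → ℂ} (h : CanRestoreBell Ψ)
    (y : Qubit × Y) : ∑ x, ‖Ψ (x, y)‖ ^ 2 ≤ 1 / 2 := by
  have h1 := h.schmidtBound.sqNorm_mulVec_le (Pi.single y 1)
  simpa [sqNorm, Pi.single_apply, apply_ite norm, ite_pow] using h1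

end

/-! ### Sufficiency: a one-way protocol from Bob to Alice -/

section
variable {a b : Type} [Fintype a] [DecidableEq a] [Fintype b] [DecidableEq b]

/-- Local filter mapping `|i⟩` to `√p |0⟩` and `|j⟩` to `√q |1⟩`. -/
noncomputable def pairFilter (i j : b) (p q : ℝ) : Matrix (Fin 2) b ℂ :=
  Matrix.of ![((√p : ℝ) : ℂ) • basisKet i, ((√q : ℝ) : ℂ) • basisKet j]

omit [Fintype b] in
theorem pairFilter_conjTranspose_mul {i j : b} {p q : ℝ} (hp : 0 ≤ p) (hq : 0 ≤ q) :
    (pairFilter i j p q)ᴴ * pairFilter i j p q =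
      (p : ℂ) • Matrix.diagonal (basisKet i) + (q : ℂ) • Matrix.diagonal (basisKet j) := by
  have h (x : ℝ) (hx : 0 ≤ x) : ((√x : ℝ) : ℂ) * ((√x : ℝ) : ℂ) = x := by
    rw [← Complex.ofReal_mul, Real.mul_self_sqrt hx]
  ext x y
  simp only [pairFilter, Matrix.mul_apply, Fin.sum_univ_two, Matrix.conjTranspose_apply,
    Matrix.of_apply, Matrix.add_apply, Matrix.smul_apply, Matrix.diagonal_apply, basisKet,
    Pi.single_apply]
  simp only [Matrix.cons_val_zero, Matrix.cons_val_one, Pi.smul_apply, Pi.single_apply,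
    smul_eq_mul]
  rw [← h p hp, ← h q hq]
  by_cases h1 : x = i <;> by_cases h2 : x = j <;> by_cases h3 : x = y <;> subst_vars <;>
    simp_all <;> grind

/-- The channel that takes the orthonormal vectors `e 0`, `e 1` to `|0⟩`, `|1⟩` on the qubit `A`,
up to a local leftover register. -/
theorem exists_channel_to_qubit {X : Type} [Fintype X] [DecidableEq X] [Nonempty X]
    {e : Qubit → Qubit × X → ℂ} (he : ∀ i j, star (e i) ⬝ᵥ e j = if i = j then 1 else 0) :
    ∃ (r : Fin (Fintype.card X)) (K : Fin 2 → Matrix (Qubit × Fin (Fintype.card X)) (Qubit × X) ℂ),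
      IsMeasurement K ∧ (∀ i, K 0 *ᵥ e i = basisKet (i, r)) ∧ ∀ i, K 1 *ᵥ e i = 0 := by
  have : NeZero (Fintype.card X) := ⟨Fintype.card_ne_zero⟩
  let r : Fin (Fintype.card X) := 0
  let σ : Qubit × X ≃ Qubit × Fin (Fintype.card X) :=
    (Equiv.refl _).prodCongr (Fintype.equivFin X)
  let T : Matrix (Qubit × Fin (Fintype.card X)) (Qubit × X) ℂ :=
    ∑ i, Matrix.vecMulVec (basisKet (i, r)) (star (e i))
  let P : Matrix (Qubit × X) (Qubit × X) ℂ := ∑ i, pureState (e i)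
  let J : Matrix (Qubit × Fin (Fintype.card X)) (Qubit × X) ℂ :=
    (1 : Matrix (Qubit × X) (Qubit × X) ℂ).submatrix σ.symm id
  have hT : Tᴴ * T = P := by
    simp [T, P, pureState, basisKet, Matrix.conjTranspose_vecMulVec, Matrix.add_mul,
      Matrix.mul_add, Matrix.vecMulVec_mul_vecMulVec]
  have hP : P * P = P := by
    simp [P, pureState, add_mul, mul_add, Matrix.vecMulVec_mul_vecMulVec, he]
  have hPs : Pᴴ = P := by
    simp [P, pureState, Matrix.conjTranspose_vecMulVec]
  have hJ : Jᴴ * J = 1 := by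
    simp [J, Matrix.conjTranspose_submatrix, Matrix.submatrix_mul_equiv]
  -- The second Kraus operator only completes the channel on the orthogonal complement; the isometry
  -- `J` gives it the same target space.
  refine ⟨r, ![T, J * (1 - P)], ?_, fun i => ?_, fun i => ?_⟩
  · rw [IsMeasurement, Fin.sum_univ_two]
    simp only [Matrix.cons_val_zero, Matrix.cons_val_one]
    rw [hT, Matrix.conjTranspose_mul, Matrix.mul_assoc, ← Matrix.mul_assoc Jᴴ, hJ, Matrix.one_mul,
      Matrix.conjTranspose_sub, Matrix.conjTranspose_one, hPs]
    simp [sub_mul, mul_sub, hP]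
  · fin_cases i <;> simp [T, Matrix.add_mulVec, Matrix.vecMulVec_mulVec, he]
  · have : P *ᵥ e i = e i := by
      fin_cases i <;> simp [P, pureState, Matrix.add_mulVec, Matrix.vecMulVec_mulVec, he]
    simp [← Matrix.mulVec_mulVec, Matrix.sub_mulVec, this]

omit [DecidableEq a] [DecidableEq b] in
theorem kronecker_mulVec_tensorKet {c d : Type} (K : Matrix c a ℂ) (L : Matrix d b ℂ)
    (u : a → ℂ) (v : b → ℂ) :
    (K ⊗ₖ L) *ᵥ tensorKet u v = tensorKet (K *ᵥ u) (L *ᵥ v) := by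
  ext p
  simp only [Matrix.mulVec, dotProduct, Fintype.sum_prod_type, tensorKet,
    Matrix.kroneckerMap_apply, Finset.sum_mul_sum]
  exact Finset.sum_congr rfl fun _ _ => Finset.sum_congr rfl fun _ _ => by ring

theorem pairFilter_mulVec {i j : b} {p q : ℝ} (v : b → ℂ) :
    pairFilter i j p q *ᵥ v = ![√p * v i, √q * v j] := by
  ext t
  fin_cases t <;> simp [pairFilter, basisKet, Matrix.mulVec, dotProduct, Pi.single_apply]

omit [DecidableEq b] in
theorem one_kronecker_mulVec_apply {d : Type} (L : Matrix d b ℂ) (ψ : a × b → ℂ) (x : a) (t : d) :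
    (((1 : Matrix a a ℂ) ⊗ₖ L) *ᵥ ψ) (x, t) = (L *ᵥ fun y => ψ (x, y)) t := by
  simp [Matrix.mulVec, dotProduct, Fintype.sum_prod_type, Matrix.one_apply, ite_mul]

theorem reducedAB_bell {R S : Type} [Fintype R] [DecidableEq R] [Fintype S] [DecidableEq S]
    (r : R) (s : S) (z : ℂ) :
    reducedAB (pureState (z • ∑ t : Qubit, tensorKet (basisKet (t, r)) (basisKet (t, s)))) =
      (2 * ‖z‖ ^ 2 : ℂ) • pureState bellKet := by
  ext p q
  obtain ⟨p1, p2⟩ := p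
  obtain ⟨q1, q2⟩ := q
  rw [reducedAB_pureState, Matrix.smul_apply, pureState_bellKet_apply, ← Complex.mul_conj']
  rw [Matrix.sum_apply, Finset.sum_eq_single r, Matrix.sum_apply, Finset.sum_eq_single s]
  · fin_cases p1 <;> fin_cases p2 <;> fin_cases q1 <;> fin_cases q2 <;>
      simp [pureState, Matrix.vecMulVec_apply, tensorKet, basisKet, mul_right_comm (2 : ℂ)]
  · intro s' _ hs
    simp [pureState, Matrix.vecMulVec_apply, tensorKet, basisKet, hs]
  · simp
  · intro r' _ hr
    simp [Matrix.sum_apply, pureState, Matrix.vecMulVec_apply, tensorKet, basisKet, hr]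
  · simp

/-- If the Schmidt weights `μ` of `Ψ` are a nonnegative combination of sums of two standard basis
vectors, then a Bell pair can be restored: Bob projects onto one of the pairs. -/
theorem canRestoreBell_of_pairs {X Y : Type} [Fintype X] [DecidableEq X] [Nonempty X] [Fintype Y]
    [DecidableEq Y] {Ψ : (Qubit × X) × (Qubit × Y) → ℂ} {A : Qubit × Y → Qubit × X → ℂ}
    (hA : ∀ k l, star (A k) ⬝ᵥ A l = if k = l then 1 else 0) {μ : Qubit × Y → ℝ}
    (hμ : ∀ k, 0 < μ k) (hsum : ∑ k, μ k = 1) (hΨ : ∀ x y, Ψ (x, y) = √(μ y) * A y x) {n : ℕ}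
    {i j : Fin n → Qubit × Y} (hij : ∀ m, i m ≠ j m) {w : Fin n → ℝ} (hw : ∀ m, 0 ≤ w m)
    (hwμ : ∀ k, ∑ m, ((if i m = k then w m else 0) + if j m = k then w m else 0) = μ k) :
    CanRestoreBell Ψ := by
  have he (m : Fin n) (s t : Qubit) :
      star (A (![i m, j m] s)) ⬝ᵥ A (![i m, j m] t) = if s = t then 1 else 0 := by
    fin_cases s <;> fin_cases t <;> simp [hA, hij, (hij m).symm]
  choose r K hK hK0 hK1 using fun m => exists_channel_to_qubit (he m)
  -- Dividing by `μ` turns both Schmidt coefficients of the pair into `√(w m)`; completeness is then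
  -- `hwμ`.
  let L (m : Fin n) := pairFilter (i m) (j m) (w m / μ (i m)) (w m / μ (j m))
  let B : Fin 1 → Matrix (Qubit × Fin 1) (Fin 2) ℂ := fun _ =>
    (1 : Matrix (Fin 2) (Fin 2) ℂ).submatrix Prod.fst id
  have hB : IsMeasurement B := by
    ext s t
    fin_cases s <;> fin_cases t <;>
      simp [B, Matrix.mul_apply, Fintype.sum_prod_type, Matrix.one_apply]
  have hL : IsMeasurement L := by
    rw [IsMeasurement]
    simp_rw [L, fun m => pairFilter_conjTranspose_mul (i := i m) (j := j m)
      (div_nonneg (hw m) (hμ (i m)).le) (div_nonneg (hw m) (hμ (j m)).le)]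
    ext x y
    simp only [Matrix.sum_apply, Matrix.add_apply, Matrix.smul_apply, Matrix.diagonal_apply,
      Matrix.one_apply, basisKet, Pi.single_apply]
    split_ifs with hxy
    · have h1 : ∑ m, ((if i m = x then w m else 0) / μ x + (if j m = x then w m else 0) / μ x) =
          1 := by
        simp_rw [← add_div]
        rw [← Finset.sum_div, hwμ, div_self (hμ x).ne']
      refine Eq.trans ?_ (congr_arg Complex.ofReal h1)
      rw [Complex.ofReal_sum]
      refine Finset.sum_congr rfl fun m _ => ?_
      simp only [eq_comm (a := x)]
      split_ifs <;> simp [*]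
    · simp
  have hpost (m : Fin n) : ((1 : Matrix (Qubit × X) (Qubit × X) ℂ) ⊗ₖ L m) *ᵥ Ψ =
      (√(w m) : ℂ) • ∑ t, tensorKet (A (![i m, j m] t)) (basisKet t) := by
    have hs (k) : ((√(w m / μ k) : ℝ) : ℂ) * (√(μ k) : ℝ) = (√(w m) : ℝ) := by
      rw [← Complex.ofReal_mul, ← Real.sqrt_mul (div_nonneg (hw m) (hμ k).le),
        div_mul_cancel₀ _ (hμ k).ne']
    ext ⟨x, t⟩
    rw [one_kronecker_mulVec_apply, pairFilter_mulVec]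
    fin_cases t <;> simp [tensorKet, basisKet, hΨ, ← mul_assoc, hs]
  have hBt (t : Fin 2) : B 0 *ᵥ basisKet t = basisKet (t, 0) := by
    ext ⟨s, u⟩
    have := Subsingleton.elim u 0
    subst this
    simp [B, basisKet, Matrix.one_apply, Pi.single_apply, Prod.ext_iff]
  refine ⟨Fintype.card X, 1, _, .bob _ L hL _ fun m => .leaf (K m) B (hK m) hB, ?_⟩
  have hterm (m : Fin n) : reducedAB (∑ s, ∑ t, (K m s ⊗ₖ B t) *
      (((1 : Matrix (Qubit × X) (Qubit × X) ℂ) ⊗ₖ L m) * pureState Ψ *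
        ((1 : Matrix (Qubit × X) (Qubit × X) ℂ) ⊗ₖ L m)ᴴ) * (K m s ⊗ₖ B t)ᴴ) =
      (2 * w m : ℂ) • pureState bellKet := by
    simp_rw [mul_pureState_mul_conjTranspose, hpost, Matrix.mulVec_smul, Matrix.mulVec_sum,
      kronecker_mulVec_tensorKet]
    rw [Fin.sum_univ_two]
    simp_rw [hK0, hK1, Fin.sum_univ_one, hBt]
    have h0 : pureState ((√(w m) : ℂ) • ∑ t : Qubit, tensorKet (0 : Qubit × Fin (Fintype.card X) → ℂ)
        (basisKet (t, (0 : Fin 1)))) = 0 := by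
      ext
      simp [pureState, tensorKet, Matrix.vecMulVec_apply]
    rw [h0, add_zero, reducedAB_bell, Complex.norm_real, Real.norm_of_nonneg (Real.sqrt_nonneg _),
      ← Complex.ofReal_pow, Real.sq_sqrt (hw m)]
  rw [reducedAB_sum]
  simp_rw [hterm]
  rw [← Finset.sum_smul, ← Finset.mul_sum]
  have h2 : 2 * ∑ m, w m = 1 := by
    rw [← hsum, ← Finset.sum_congr rfl fun k _ => hwμ k, Finset.sum_comm, Finset.mul_sum]
    exact Finset.sum_congr rfl fun m _ => by simp [Finset.sum_add_distrib, two_mul]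
  have h3 : (2 * ∑ m, (w m : ℂ)) = 1 := by exact_mod_cast h2
  rw [h3, one_smul]

end

/-- Pair all of `μ (1, e + 1)` with `μ (0, e)`. The three remaining weights satisfy the triangle
inequalities, by `h1`, `h2` and `hhalf`, so half-sums solve the pairing. -/
theorem exists_pair_weights {μ : Qubit × Qubit → ℝ} (hsum : ∑ k, μ k = 1) (e : Qubit)
    (hpos : 0 ≤ μ (1, e + 1)) (hhalf : μ (0, e) ≤ 1 / 2)
    (h1 : μ (1, e) + μ (1, e + 1) ≤ μ (0, e) + μ (0, e + 1))
    (h2 : μ (0, e + 1) + μ (1, e + 1) ≤ μ (0, e) + μ (1, e)) :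
    ∃ (i j : Fin 4 → Qubit × Qubit) (w : Fin 4 → ℝ), (∀ m, i m ≠ j m) ∧ (∀ m, 0 ≤ w m) ∧
      ∀ k, ∑ m, ((if i m = k then w m else 0) + if j m = k then w m else 0) = μ k := by
  have hs : μ (0, e) + μ (0, e + 1) + μ (1, e) + μ (1, e + 1) = 1 := by
    rw [← hsum]
    fin_cases e <;> simp [Fintype.sum_prod_type] <;> ring
  refine ⟨![(0, e), (0, e), (0, e), (0, e + 1)], ![(1, e + 1), (0, e + 1), (1, e), (1, e)],
    ![μ (1, e + 1), (μ (0, e) - μ (1, e + 1) + μ (0, e + 1) - μ (1, e)) / 2,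
      (μ (0, e) - μ (1, e + 1) + μ (1, e) - μ (0, e + 1)) / 2,
      (μ (0, e + 1) + μ (1, e) - μ (0, e) + μ (1, e + 1)) / 2], fun m => ?_, fun m => ?_, ?_⟩
  · fin_cases m <;> simp
  · fin_cases m <;> simp <;> linarith
  · rintro ⟨k, l⟩
    fin_cases e <;> fin_cases k <;> fin_cases l <;> simp [Fin.sum_univ_four] <;> ring

/-! ### The transferred state -/

/-- Amplitudes of the transferred state: Alice's vector attached to Bob's basis state. -/
theorem transferToAlice_apply (θ α β γ : ℝ) (a a' k b b' : Qubit) :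
    transferToAlice (tensorKet (linkKet θ) (wKet α β γ)) ((a, a', k), (b, b')) =
      (if a = b then ![(Real.cos θ : ℂ), Real.sin θ] b else 0) *
        (![![![0, α], ![γ, 0]], ![![β, 0], ![0, 0]]] b' a' k : ℂ) := by
  simp only [transferToAlice, tensorKet]
  congr 1
  · fin_cases a <;> fin_cases b <;> simp [linkKet, basisKet]
  · fin_cases a' <;> fin_cases b' <;> fin_cases k <;> simp [wKet, basisKet]

theorem sum_norm_transferToAlice_sq (θ α β γ : ℝ) (b b' : Qubit) :
    ∑ x, ‖transferToAlice (tensorKet (linkKet θ) (wKet α β γ)) (x, (b, b'))‖ ^ 2 =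
      ![Real.cos θ, Real.sin θ] b ^ 2 * ![α ^ 2 + γ ^ 2, β ^ 2] b' := by
  simp only [Fintype.sum_prod_type, transferToAlice_apply]
  fin_cases b <;> fin_cases b' <;> simp [mul_pow] <;> ring_nf <;>
    simp [Complex.norm_real, ← Complex.ofReal_cos, ← Complex.ofReal_sin] <;> ring

theorem transferRestorable_of_le {θ : ℝ} (hs : 0 < Real.sin θ) (hsc : Real.sin θ ≤ Real.cos θ)
    {α β γ : ℝ} (hα : 0 < α) (hβ : 0 < β) (hγ : 0 < γ) (hnorm : α ^ 2 + β ^ 2 + γ ^ 2 = 1)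
    (h0 : Real.cos θ ^ 2 * (α ^ 2 + γ ^ 2) ≤ 1 / 2) (h1 : Real.cos θ ^ 2 * β ^ 2 ≤ 1 / 2) :
    TransferRestorable θ (wKet α β γ) := by
  have hc := hs.trans_le hsc
  have hδ : 0 < α ^ 2 + γ ^ 2 := by positivity
  set δ := √(α ^ 2 + γ ^ 2) with hδdef
  have hδpos : 0 < δ := Real.sqrt_pos.2 hδ
  have hδsq : δ ^ 2 = α ^ 2 + γ ^ 2 := Real.sq_sqrt hδ.le
  let g : Qubit → ℝ := ![Real.cos θ, Real.sin θ]
  let h : Qubit → ℝ := ![δ, β]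
  have hg (b) : 0 < g b := by fin_cases b <;> simpa [g]
  have hh (b) : 0 < h b := by fin_cases b <;> simpa [h]
  let μ : Qubit × Qubit → ℝ := fun y => (g y.1 * h y.2) ^ 2
  have hsum : ∑ k, μ k = 1 := by
    simp only [μ, Fintype.sum_prod_type, Fin.sum_univ_two, g, h, Matrix.cons_val_zero,
      Matrix.cons_val_one]
    linear_combination (Real.cos θ ^ 2 + Real.sin θ ^ 2) * (hδsq + hnorm) +
      Real.sin_sq_add_cos_sq θ
  have hsc2 : Real.sin θ ^ 2 ≤ Real.cos θ ^ 2 := by gcongr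
  -- `e` marks the larger of δ², β², so `(0, e)` carries the largest weight.
  obtain ⟨e, he⟩ : ∃ e : Qubit, h (e + 1) ^ 2 ≤ h e ^ 2 := by
    rcases le_total (h 0 ^ 2) (h 1 ^ 2) with hle | hle
    exacts [⟨1, hle⟩, ⟨0, hle⟩]
  obtain ⟨i, j, w, hij, hw, hwμ⟩ := exists_pair_weights hsum e (sq_nonneg _)
    (by fin_cases e <;> simp [μ, g, h, mul_pow, hδsq] <;> linarith)
    (by
      simp only [μ, mul_pow, g, Matrix.cons_val_zero, Matrix.cons_val_one]
      gcongr)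
    (by
      simp only [μ, mul_pow, g, Matrix.cons_val_zero, Matrix.cons_val_one]
      gcongr)
  -- Alice's Schmidt vectors: on `A' K`, (α|01⟩ + γ|10⟩)/δ for Bob's 0 and |00⟩ for his 1.
  let A : Qubit × Qubit → Qubit × Qubit × Qubit → ℂ := fun y x =>
    (if x.1 = y.1 then 1 else 0) *
      ![![![0, (α / δ : ℂ)], ![(γ / δ : ℂ), 0]], ![![1, 0], ![0, 0]]] y.2 x.2.1 x.2.2
  refine canRestoreBell_of_pairs (A := A) (μ := μ) ?_ (fun k => pow_pos (mul_pos (hg _) (hh _)) 2)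
    hsum ?_ hij hw hwμ
  · have hn : (α / δ : ℂ) * (α / δ) + (γ / δ) * (γ / δ) = 1 := by
      have : (α / δ) * (α / δ) + (γ / δ) * (γ / δ) = 1 := by
        field_simp
        exact hδsq.symm
      exact_mod_cast this
    rintro ⟨k, k'⟩ ⟨l, l'⟩
    fin_cases k <;> fin_cases k' <;> fin_cases l <;> fin_cases l' <;>
      simp [A, dotProduct, Fintype.sum_prod_type, hn]
  · rintro ⟨a, a', k⟩ ⟨b, b'⟩
    have hδ0 : (δ : ℂ) ≠ 0 := by exact_mod_cast hδpos.ne'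
    rw [transferToAlice_apply, Real.sqrt_sq (mul_pos (hg _) (hh _)).le]
    simp only [A]
    by_cases hab : a = b
    · simp only [hab, if_true]
      fin_cases b <;> fin_cases b' <;> fin_cases a' <;> fin_cases k <;>
        simp [g, h, mul_assoc, mul_div_cancel₀, hδ0]
    · simp [hab]

theorem mainTheorem3 (θ : ℝ) (hθ_pos : 0 < θ) (hθ_le : θ ≤ Real.pi / 4)
    (α β γ : ℝ) (hα : 0 < α) (hβ : 0 < β) (hγ : 0 < γ)
    (hnorm : α ^ 2 + β ^ 2 + γ ^ 2 = 1) :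
    TransferRestorable θ (wKet α β γ) ↔
      (1 - Real.tan θ ^ 2) / 2 ≤ β ^ 2 ∧ β ^ 2 ≤ (1 + Real.tan θ ^ 2) / 2 := by
  have hpi := Real.pi_pos
  have hs : 0 < Real.sin θ := Real.sin_pos_of_pos_of_lt_pi hθ_pos (by linarith)
  have hsc : Real.sin θ ≤ Real.cos θ := by
    rw [← Real.sin_pi_div_two_sub]
    exact Real.sin_le_sin_of_le_of_le_pi_div_two (by linarith) (by linarith) (by linarith)
  have hc := hs.trans_le hsc
  have ht : Real.cos θ ^ 2 * (1 + Real.tan θ ^ 2) = 1 := by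
    rw [Real.tan_eq_sin_div_cos, div_pow, mul_add, mul_div_cancel₀ _ (by positivity)]
    linarith [Real.sin_sq_add_cos_sq θ]
  have hc2 : 0 < Real.cos θ ^ 2 := by positivity
  -- A lower bound on β² is an upper bound on 1 - β² = α² + γ²; `ht` clears the tangent.
  have h0 : (1 - Real.tan θ ^ 2) / 2 ≤ β ^ 2 ↔ Real.cos θ ^ 2 * (α ^ 2 + γ ^ 2) ≤ 1 / 2 := by
    rw [← mul_le_mul_iff_right₀ hc2]
    constructor <;> intro h <;> nlinarith
  have h1 : β ^ 2 ≤ (1 + Real.tan θ ^ 2) / 2 ↔ Real.cos θ ^ 2 * β ^ 2 ≤ 1 / 2 := by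
    rw [← mul_le_mul_iff_right₀ hc2]
    constructor <;> intro h <;> linarith
  rw [h0, h1]
  refine ⟨fun h => ?_, fun h => transferRestorable_of_le hs hsc hα hβ hγ hnorm h.1 h.2⟩
  have key := CanRestoreBell.le_half h
  exact ⟨by simpa [sum_norm_transferToAlice_sq] using key (0, 0),
    by simpa [sum_norm_transferToAlice_sq] using key (0, 1)⟩
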